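/- Let $\Omega$ be a non-empty set, $\mathcal A$ an algebra of subsets of $\Omega$ and $\mathcal F=\sigma(\mathcal A)$; let $\mathbb P(\mathcal F)$ be the set of countably additive probabilities on $\mathcal F$. Let $\bar x$ be a positive, real-valued, finitely additive set function on all subsets of $\Omega\times\mathbb R_+$ with $\lim_{t\to\infty}\bar x(\Omega\times{]t,\infty[})=0$, and put $\|\bar x\|=\bar x(\Omega\times\mathbb R_+)$. Write $\bar{\mathcal F}=\{F\times\mathbb R_+:F\in\mathcal F\}$, and write $L^1(\bar x)$ for the space of functions $h:\Omega\times\mathbb R_+\to\mathbb R$ that are $\bar x$-integrable in the sense of Dunford and Schwartz, with integral $\bar x(h)$ and norm $\bar x(|h|)$. That is, there are finitely-valued $f_n$ with $f_n\to h$ in $\bar x$-measure and $\bar x(|f_n-f_m|)\to0$, and $\bar x(h)=\lim_n\bar x(f_n)$. For a family $\mathcal C$ of subsets of $\Omega$ let $\bar{\mathcal P}(\mathcal C)$ be the collection of all disjoint unions $$H=(F_0\times\{0\})\cup\bigcup_{n=1}^N F_n\times{]t_n,u_n]},\qquad F_0,F_n\in\mathcal C,\ t_n\le u_n\ \text{in}\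 \mathbb R_+ .$$ For $P\in\mathbb P(\mathcal F)$ let $\mathfrak A(P)$ be the set of families $A=(A_t)_{t\in\mathbb R_+}$ of $\mathcal F$-measurable random variables with $P(0=A_0\le A_t\le A_u)=1$ for all $t\le u$ and $A_\infty=\lim_n A_n\in L^1(P)$. For such $A$ and $H$ put $\int \mathbf 1_H\,dA=\sum_{n=1}^N\mathbf 1_{F_n}(A_{u_n}-A_{t_n})$. **Theorem.** The following are equivalent. 1. There exists $P\in\mathbb P(\mathcal F)$ and, given $P$, an $A\in\mathfrak A(P)$ such that $\bar x(H)=P\int\mathbf 1_H\,dA$ for all $H\in\bar{\mathcal P}(\mathcal F)$. This $A$ is unique up to modification: every $B\in\mathfrak A(P)$ with $\bar x(H)=P\int\mathbf 1_H\,dB$ for all $H\in\bar{\mathcal P}(\mathcal A)$ satisfies $P(B_t=A_t)=1$ for every $t\in\mathbb R_+$. 2. $\bar x$ is countably additive on $\bar{\mathcal F}$, and $\bar x(\Omega\times\{0\})=0$. 3. There exists $P\in\mathbb P(\mathcal F)$ such that for each $h\in L^1(\bar x)$ the equation $$\bar x(bh)=P\big(b\,I_{\bar x}(h)\big)\qquad\text{for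 all bounded }\mathcal F\text{-measurable } b:\Omega\to\mathbb R$$ has a unique solution $I_{\bar x}(h)\in L^1(P)$, and $I_{\bar x}(\mathbf 1_{\Omega\times\{0\}})=0$. Here $bh$ is the function $(\omega,t)\mapsto b(\omega)h(\omega,t)$, and the equation includes the assertion that $bh\in L^1(\bar x)$. Moreover, for any $P$ as in 3, the operator $I_{\bar x}:L^1(\bar x)\to L^1(P)$ has the following properties. * It is positive and linear. * It is continuous: $\|I_{\bar x}(h)\|_{L^1(P)}\le\bar x(|h|)$ for $h\in L^1(\bar x)$, with equality if $h\ge0$. In particular $|h|\in L^1(\bar x)$. * Its norm with respect to the uniform norm on bounded functions is $\|\bar x\|$: $\ \sup\{\|I_{\bar x}(h)\|_{L^1(P)}:h\in L^1(\bar x),\ |h|\le1\}=\|\bar x\|$. * If $h_n\in L^1(\bar x)$ for $n\in\mathbb N$, $\sup_n|h_n|$ is finite everywhere and belongs to $L^1(\bar x)$, and $\lim_nP^*(\sup_t|h_{n}(\cdot,t)|>\eta)=0$ for each $\eta>0$ (with $P^*$ the outer measure generated by $P$), then $I_{\bar x}(h_n)\to0$ in $L^1(P)$. -/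

import Mathlib

open MeasureTheory Filter Set Topology
open scoped NNReal

noncomputable section

namespace FinAdd

/-- A member of `ba(2^X)₊`: a positive (finite) finitely additive set function defined on
all subsets of `X`. -/
abbrev PosBa (X : Type*) := AddContent ℝ≥0 (Set.univ : Set (Set X))

/-- The norm of a positive finitely additive set function, i.e. its total mass. -/
def mass {X : Type*} (m : PosBa X) : ℝ := (m Set.univ : ℝ)

/-- `∫ f dm = ∑ y, y * m {f = y}` for a function `f` with finite range. -/
def simpleIntegral {X : Type*} (m : PosBa X) (f : X → ℝ) : ℝ :=
  ∑ᶠ y : ℝ, y * (m (f ⁻¹' {y}) : ℝ)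

/-- `h` is integrable with respect to the finitely additive set function `m`, with integral `c`,
in the sense of Dunford and Schwartz: there are simple functions which converge to `h` in
`m`-measure, which are Cauchy in mean, and whose integrals converge to `c`. -/
def HasIntegral {X : Type*} (m : PosBa X) (h : X → ℝ) (c : ℝ) : Prop :=
  ∃ f : ℕ → X → ℝ,
    (∀ n, (Set.range (f n)).Finite) ∧
    (∀ η : ℝ, 0 < η → Tendsto (fun n => (m {z | η < |f n z - h z|} : ℝ)) atTop (𝓝 0)) ∧
    Tendsto (fun p : ℕ × ℕ => simpleIntegral m (fun z => |f p.1 z - f p.2 z|)) atTop (𝓝 0) ∧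
    Tendsto (fun n => simpleIntegral m (f n)) atTop (𝓝 c)

/-- `h ∈ L¹(m)`. -/
def MemL1 {X : Type*} (m : PosBa X) (h : X → ℝ) : Prop :=
  ∃ c, HasIntegral m h c

/-- `m` is countably additive on the family `𝒞` of sets. -/
def CountablyAdditiveOn {X : Type*} (m : PosBa X) (𝒞 : Set (Set X)) : Prop :=
  ∀ S : ℕ → Set X, (∀ n, S n ∈ 𝒞) → Pairwise (Function.onFun Disjoint S) → (⋃ n, S n) ∈ 𝒞 →
    HasSum (fun n => (m (S n) : ℝ)) (m (⋃ n, S n))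

section Processes

variable {Ω : Type*}

/-- `x̄ ∈ ℳ`: the mass of `Ω × ]t, ∞[` vanishes as `t → ∞`. -/
def IsDoleans (x : PosBa (Ω × ℝ≥0)) : Prop :=
  Tendsto (fun t : ℝ≥0 => (x (Set.univ ×ˢ Set.Ioi t) : ℝ)) atTop (𝓝 0)

/-- The σ-algebra `ℱ ⊗ {∅, ℝ₊}` of subsets of `Ω × ℝ₊`, where `ℱ` is the σ-algebra of `Ω`. -/
def fBar (Ω : Type*) [MeasurableSpace Ω] : Set (Set (Ω × ℝ≥0)) :=
  {S | ∃ F : Set Ω, MeasurableSet F ∧ S = F ×ˢ Set.univ}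

/-- A disjoint union `F₀ × {0} ∪ ⋃ₙ Fₙ × ]sₙ, uₙ]` with `F₀, Fₙ` in a family `𝒞` of subsets
of `Ω`. -/
structure RectUnion (𝒞 : Set (Set Ω)) where
  N : ℕ
  F₀ : Set Ω
  F : Fin N → Set Ω
  s : Fin N → ℝ≥0
  u : Fin N → ℝ≥0
  F₀_mem : F₀ ∈ 𝒞
  F_mem : ∀ n, F n ∈ 𝒞
  s_le_u : ∀ n, s n ≤ u n
  disj : Pairwise fun i j => Disjoint (F i ×ˢ Set.Ioc (s i) (u i)) (F j ×ˢ Set.Ioc (s j) (u j))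

/-- The subset of `Ω × ℝ₊` described by the data. -/
def RectUnion.carrier {𝒞 : Set (Set Ω)} (H : RectUnion 𝒞) : Set (Ω × ℝ≥0) :=
  H.F₀ ×ˢ {0} ∪ ⋃ n, H.F n ×ˢ Set.Ioc (H.s n) (H.u n)

/-- The elementary integral `∫ 1_H dA = ∑ₙ 1_{Fₙ} (A_{uₙ} - A_{sₙ})`. -/
def RectUnion.integral {𝒞 : Set (Set Ω)} (H : RectUnion 𝒞) (A : ℝ≥0 → Ω → ℝ) (ω : Ω) : ℝ :=
  ∑ n, (H.F n).indicator (fun ω' => A (H.u n) ω' - A (H.s n) ω') ω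

variable [MeasurableSpace Ω]

/-- `A ∈ 𝔄(P)`: each `A t` is a random variable, `P(0 = A₀ ≤ A_t ≤ A_u) = 1` for `t ≤ u`, and
`A_∞ = lim A_n` (which exists a.s. by monotonicity) is in `L¹(P)`. -/
structure IsIncreasing (P : Measure Ω) (A : ℝ≥0 → Ω → ℝ) : Prop where
  measurable : ∀ t, Measurable (A t)
  mono : ∀ t u, t ≤ u → ∀ᵐ ω ∂P, A 0 ω = 0 ∧ 0 ≤ A t ω ∧ A t ω ≤ A u ω
  integrable_infty : ∃ A' : Ω → ℝ, Integrable A' P ∧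
    ∀ᵐ ω ∂P, Tendsto (fun n : ℕ => A n ω) atTop (𝓝 (A' ω))

/-- `x̄(H) = P ∫ 1_H dA` for all disjoint unions `H` of rectangles with bases in `𝒞`. -/
def Represents (𝒞 : Set (Set Ω)) (x : PosBa (Ω × ℝ≥0)) (P : Measure Ω) (A : ℝ≥0 → Ω → ℝ) : Prop :=
  ∀ H : RectUnion 𝒞, (x H.carrier : ℝ) = ∫ ω, H.integral A ω ∂P

/-- `g ∈ L¹(P)` solves `x̄(b h) = P(b g)` for all bounded measurable `b` on `Ω`. -/
def Solves (x : PosBa (Ω × ℝ≥0)) (P : Measure Ω) (h : Ω × ℝ≥0 → ℝ) (g : Lp ℝ 1 P) : Prop :=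
  ∀ b : Ω → ℝ, Measurable b → (∃ C, ∀ ω, |b ω| ≤ C) →
    HasIntegral x (fun z => b z.1 * h z) (∫ ω, b ω * g ω ∂P)

/-- `I` is the operator `I_x̄` relative to `P`: for each `h ∈ L¹(x̄)` the unique solution in `L¹(P)`
of `x̄(b h) = P(b g)` is `g = I h`; moreover `I` maps the indicator of `Ω × {0}` to `0`.
The values of `I` outside `L¹(x̄)` are irrelevant. -/
structure IsIntegralOperator (x : PosBa (Ω × ℝ≥0)) (P : Measure Ω)
    (I : (Ω × ℝ≥0 → ℝ) → Lp ℝ 1 P) : Prop where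
  solves : ∀ h, MemL1 x h → Solves x P h (I h)
  unique : ∀ h, MemL1 x h → ∀ g : Lp ℝ 1 P, Solves x P h g → g = I h
  zero : I ((Set.univ ×ˢ {0} : Set (Ω × ℝ≥0)).indicator fun _ => 1) = 0

end Processes

end FinAdd

end

/-!
Everything rests on one measure-theoretic fact: if `F ↦ x̄(F × ℝ₊)` is countably additive on `ℱ`,
then so is `F ↦ x̄((F × ℝ₊) ∩ E)` for *every* set `E ⊆ Ω × ℝ₊`, because it and its analogue for the
complement of `E` add up to a countably additive function while neither can exceed its share
(`CountablyAdditiveOn.hasSum_slice`). Let `P` be the normalization of `F ↦ x̄(F × ℝ₊)`. Each slice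
is then absolutely continuous with respect to `P` and has a Radon–Nikodym density.

The densities for `E = Ω × [0, t]` form the increasing process `A`
(`CountablyAdditiveOn.exists_isIncreasing`). It is integrable at infinity since all of them are
dominated by the density for `E = Ω × ℝ₊`, and it is unique because `𝒜` is a `π`-system generating
`ℱ`. Conversely, `A_∞` is a density of `F ↦ x̄(F × ℝ₊)`, as no mass of `x̄` escapes to infinity.

The density for `E` is also `I_x̄(1_E)`, which by linearity defines `I_x̄` on functions with finite
range. Testing `x̄(b h) = P(b g)` with `b = sign g` gives `‖g‖ ≤ x̄(|h|)` (`Solves.norm_le`). This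
contractivity yields uniqueness of the solution, and existence for every `h ∈ L¹(x̄)`: along a
sequence of simple functions determining `h` the solutions are Cauchy in `L¹(P)`, and their limit
solves the equation for `h` (`Determines.hasIntegral_mul`, `CountablyAdditiveOn.exists_solves`).
Conversely, `I_x̄(1)` is a density of `F ↦ x̄(F × ℝ₊)`.

The properties of `I_x̄` follow from those of the Dunford–Schwartz integral. For dominated
convergence, `|h_n| ≤ η + 1_{F × ℝ₊} sup_n |h_n|` where `F ∈ ℱ` covers
`{ω | ∃ t, η < |h_n (ω, t)|}` and has the same outer measure; hence
`‖I_x̄(h_n)‖ ≤ η ‖x̄‖ + ∫_F I_x̄(sup_n |h_n|) dP`, and `P F → 0`.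
-/

namespace FinAdd

/-! ### Positive finitely additive set functions -/

section SetFunction

variable {X : Type*} (m : PosBa X)

theorem PosBa.union {A B : Set X} (h : Disjoint A B) : m (A ∪ B) = m A + m B :=
  addContent_union' (mem_univ _) (mem_univ _) (mem_univ _) h

theorem PosBa.mono {A B : Set X} (h : A ⊆ B) : m A ≤ m B := by
  rw [← union_sdiff_cancel h, m.union disjoint_sdiff_right]
  exact le_self_add

theorem PosBa.union_le (A B : Set X) : m (A ∪ B) ≤ m A + m B := by
  rw [← union_sdiff_self, m.union disjoint_sdiff_right]
  exact add_le_add le_rfl (m.mono sdiff_subset)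

theorem PosBa.biUnion {ι : Type*} (s : Finset ι) (F : ι → Set X)
    (h : (s : Set ι).PairwiseDisjoint F) : m (⋃ i ∈ s, F i) = ∑ i ∈ s, m (F i) :=
  addContent_biUnion (fun _ _ => mem_univ _) h (mem_univ _)

theorem mass_nonneg : 0 ≤ mass m := NNReal.coe_nonneg _

end SetFunction

/-! ### The integral of functions with finite range -/

section SimpleIntegral

variable {X : Type*} {m : PosBa X}

theorem finite_range_comp₂ {f g : X → ℝ} (hf : (range f).Finite) (hg : (range g).Finite)
    (φ : ℝ → ℝ → ℝ) : (range fun z => φ (f z) (g z)).Finite := by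
  refine (Finite.image2 φ hf hg).subset ?_
  rintro _ ⟨z, rfl⟩
  exact mem_image2_of_mem (mem_range_self z) (mem_range_self z)

theorem finite_range_comp {f : X → ℝ} (hf : (range f).Finite) (φ : ℝ → ℝ) :
    (range fun z => φ (f z)).Finite :=
  finite_range_comp₂ hf hf fun a _ => φ a

theorem finite_range_indicator (E : Set X) : (range (E.indicator fun _ => (1 : ℝ))).Finite := by
  refine (Set.toFinite {0, 1}).subset ?_
  rintro _ ⟨z, rfl⟩
  by_cases h : z ∈ E <;> simp [h]

/-- A finite partition, given as the fibres of `π`, on whose pieces the function is constant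
computes the integral, even if it is finer than the partition into level sets. This is what makes
the integral additive. -/
theorem simpleIntegral_comp {ι : Type*} {π : X → ι} (hπ : (range π).Finite) (u : ι → ℝ) :
    simpleIntegral m (fun z => u (π z)) = ∑ i ∈ hπ.toFinset, u i * (m (π ⁻¹' {i}) : ℝ) := by
  classical
  have hsub : Function.support (fun y : ℝ => y * (m ((fun z => u (π z)) ⁻¹' {y}) : ℝ)) ⊆
      (hπ.toFinset.image u : Finset ℝ) := by
    intro y hy
    by_contra hn
    apply hy
    have : (fun z => u (π z)) ⁻¹' {y} = ∅ := by
      ext z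
      simp only [mem_preimage, mem_singleton_iff, mem_empty_iff_false, iff_false]
      rintro rfl
      exact hn (by simp)
    simp [this]
  rw [simpleIntegral, finsum_eq_sum_of_support_subset _ hsub,
    ← Finset.sum_fiberwise_of_maps_to (g := u) (t := hπ.toFinset.image u)
      (fun i hi => Finset.mem_image_of_mem u hi)]
  refine Finset.sum_congr rfl fun y _ => ?_
  have hset : (fun z => u (π z)) ⁻¹' {y} =
      ⋃ i ∈ hπ.toFinset.filter (fun i => u i = y), π ⁻¹' {i} := by
    ext z; simp
  rw [hset, m.biUnion, NNReal.coe_sum, Finset.mul_sum]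
  · refine Finset.sum_congr rfl fun i hi => ?_
    rw [(Finset.mem_filter.1 hi).2]
  · intro i _ j _ hij
    exact Disjoint.preimage π (by simpa using hij)

theorem simpleIntegral_nonneg {f : X → ℝ} (h : ∀ z, 0 ≤ f z) : 0 ≤ simpleIntegral m f := by
  refine finsum_nonneg fun y => ?_
  rcases eq_or_ne (f ⁻¹' {y}) ∅ with h0 | h0
  · simp [h0]
  · obtain ⟨z, rfl⟩ := nonempty_iff_ne_empty.2 h0
    exact mul_nonneg (h z) (NNReal.coe_nonneg _)

theorem simpleIntegral_add {f g : X → ℝ} (hf : (range f).Finite) (hg : (range g).Finite) :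
    simpleIntegral m (fun z => f z + g z) = simpleIntegral m f + simpleIntegral m g := by
  have hπ : (range fun z => (f z, g z)).Finite := by
    refine (hf.prod hg).subset ?_
    rintro _ ⟨z, rfl⟩
    exact ⟨mem_range_self z, mem_range_self z⟩
  have h₁ := simpleIntegral_comp (m := m) hπ (fun p => p.1 + p.2)
  have h₂ := simpleIntegral_comp (m := m) hπ (fun p => p.1)
  have h₃ := simpleIntegral_comp (m := m) hπ (fun p => p.2)
  simp only [add_mul, Finset.sum_add_distrib] at h₁
  rw [← h₂, ← h₃] at h₁
  exact h₁

theorem simpleIntegral_smul {f : X → ℝ} (hf : (range f).Finite) (a : ℝ) :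
    simpleIntegral m (fun z => a * f z) = a * simpleIntegral m f := by
  have h₁ := simpleIntegral_comp (m := m) hf (fun y => a * y)
  have h₂ := simpleIntegral_comp (m := m) hf (fun y => y)
  rw [h₁, h₂, Finset.mul_sum]
  exact Finset.sum_congr rfl fun _ _ => mul_assoc _ _ _

theorem simpleIntegral_sub {f g : X → ℝ} (hf : (range f).Finite) (hg : (range g).Finite) :
    simpleIntegral m (fun z => f z - g z) = simpleIntegral m f - simpleIntegral m g := by
  have := simpleIntegral_add (m := m) hf (finite_range_comp hg fun a => -1 * a)
  rw [simpleIntegral_smul hg] at this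
  rw [sub_eq_add_neg, ← neg_one_mul, ← this]
  simp only [neg_one_mul, sub_eq_add_neg]

theorem simpleIntegral_mono {f g : X → ℝ} (hf : (range f).Finite) (hg : (range g).Finite)
    (h : ∀ z, f z ≤ g z) : simpleIntegral m f ≤ simpleIntegral m g := by
  rw [← sub_nonneg, ← simpleIntegral_sub hg hf]
  exact simpleIntegral_nonneg fun z => sub_nonneg.2 (h z)

theorem simpleIntegral_indicator (E : Set X) :
    simpleIntegral m (E.indicator fun _ => 1) = m E := by
  classical
  have hπ : (range fun z => decide (z ∈ E)).Finite := toFinite _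
  have h := simpleIntegral_comp (m := m) hπ (fun b => if b then 1 else 0)
  have h' : (E.indicator fun _ => (1 : ℝ)) =
      fun z => (fun b : Bool => if b then (1 : ℝ) else 0) (decide (z ∈ E)) := by
    ext z; simp [indicator]
  rw [h', h, Finset.sum_subset (Finset.subset_univ _)]
  · have : (fun z => decide (z ∈ E)) ⁻¹' {true} = E := by ext; simp
    simp [this]
  · intro b _ hb
    have : (fun z => decide (z ∈ E)) ⁻¹' {b} = ∅ := by
      ext z
      simp only [mem_preimage, mem_singleton_iff, mem_empty_iff_false, iff_false]
      rintro rfl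
      exact hb (hπ.mem_toFinset.2 (mem_range_self z))
    simp [this]

theorem simpleIntegral_const (a : ℝ) : simpleIntegral m (fun _ => a) = a * mass m := by
  have h := simpleIntegral_smul (m := m) (finite_range_indicator univ) a
  rw [simpleIntegral_indicator] at h
  simpa [mass] using h

theorem abs_simpleIntegral_le {f : X → ℝ} (hf : (range f).Finite) :
    |simpleIntegral m f| ≤ simpleIntegral m (fun z => |f z|) := by
  rw [abs_le, ← neg_one_mul, ← simpleIntegral_smul (finite_range_comp hf abs)]
  refine ⟨simpleIntegral_mono (finite_range_comp hf fun a => -1 * |a|) hf fun z => ?_,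
    simpleIntegral_mono hf (finite_range_comp hf abs) fun z => le_abs_self _⟩
  rw [neg_one_mul]
  exact neg_abs_le _

end SimpleIntegral

/-! ### The Dunford–Schwartz integral -/

section DunfordSchwartz

variable {X : Type*} {m : PosBa X}

/-- `f` is a determining sequence for `h`: finitely-valued functions converging to `h` in
`m`-measure and Cauchy in mean. -/
structure Determines (m : PosBa X) (f : ℕ → X → ℝ) (h : X → ℝ) : Prop where
  finite : ∀ n, (range (f n)).Finite
  inMeasure : ∀ η : ℝ, 0 < η → Tendsto (fun n => (m {z | η < |f n z - h z|} : ℝ)) atTop (𝓝 0)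
  cauchy : Tendsto (fun p : ℕ × ℕ => simpleIntegral m (fun z => |f p.1 z - f p.2 z|)) atTop (𝓝 0)

theorem Determines.hasIntegral {f : ℕ → X → ℝ} {h : X → ℝ} (hf : Determines m f h) {c : ℝ}
    (hc : Tendsto (fun n => simpleIntegral m (f n)) atTop (𝓝 c)) : HasIntegral m h c :=
  ⟨f, hf.finite, hf.inMeasure, hf.cauchy, hc⟩

theorem HasIntegral.exists_determines {h : X → ℝ} {c : ℝ} (hh : HasIntegral m h c) :
    ∃ f, Determines m f h ∧ Tendsto (fun n => simpleIntegral m (f n)) atTop (𝓝 c) := by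
  obtain ⟨f, h₁, h₂, h₃, h₄⟩ := hh
  exact ⟨f, ⟨h₁, h₂, h₃⟩, h₄⟩

theorem Determines.exists_tendsto {f : ℕ → X → ℝ} {h : X → ℝ} (hf : Determines m f h) :
    ∃ c, Tendsto (fun n => simpleIntegral m (f n)) atTop (𝓝 c) := by
  refine cauchySeq_tendsto_of_complete ?_
  rw [cauchySeq_iff_tendsto_dist_atTop_0]
  refine squeeze_zero (fun _ => dist_nonneg) (fun p => ?_) hf.cauchy
  rw [Real.dist_eq, ← simpleIntegral_sub (hf.finite _) (hf.finite _)]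
  exact abs_simpleIntegral_le (finite_range_comp₂ (hf.finite _) (hf.finite _) fun a b => a - b)

/-- A sequence whose errors are controlled by those of two determining sequences, up to uniformly
vanishing terms, is determining. All closure properties of `L¹(m)` come from this lemma. -/
theorem Determines.of_le {f f' g : ℕ → X → ℝ} {h h' k : X → ℝ} (hf : Determines m f h)
    (hf' : Determines m f' h') (hg : ∀ n, (range (g n)).Finite) {C : ℝ} (hC : 0 < C) {e : ℕ → ℝ}
    (he : Tendsto e atTop (𝓝 0))
    (hgk : ∀ n z, |g n z - k z| ≤ C * (|f n z - h z| + |f' n z - h' z|) + e n)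
    (hgg : ∀ p q z, |g p z - g q z| ≤ C * (|f p z - f q z| + |f' p z - f' q z|) + (e p + e q)) :
    Determines m g k := by
  refine ⟨hg, fun η hη => ?_, ?_⟩
  · have hδ : 0 < η / (4 * C) := by positivity
    have hlim := (hf.inMeasure _ hδ).add (hf'.inMeasure _ hδ)
    rw [add_zero] at hlim
    refine squeeze_zero' (Eventually.of_forall fun _ => NNReal.coe_nonneg _) ?_ hlim
    filter_upwards [he.eventually (gt_mem_nhds (half_pos hη))] with n hn
    rw [← NNReal.coe_add, NNReal.coe_le_coe]
    refine (m.mono ?_).trans (m.union_le _ _)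
    intro z hz
    by_contra hcon
    simp only [mem_union, mem_ofPred_eq, not_or, not_lt] at hcon hz
    have h₁ : C * (|f n z - h z| + |f' n z - h' z|) ≤ C * (η / (4 * C) + η / (4 * C)) :=
      mul_le_mul_of_nonneg_left (add_le_add hcon.1 hcon.2) hC.le
    have h₂ : C * (η / (4 * C) + η / (4 * C)) = η / 2 := by field_simp; norm_num
    linarith [hgk n z]
  · have he₂ : Tendsto (fun p : ℕ × ℕ => e p.1 + e p.2) atTop (𝓝 0) := by
      rw [← prod_atTop_atTop_eq]
      simpa using (he.comp tendsto_fst).add (he.comp tendsto_snd)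
    have hlim := ((hf.cauchy.add hf'.cauchy).const_mul C).add (he₂.mul_const (mass m))
    simp only [add_zero, mul_zero, zero_mul] at hlim
    refine squeeze_zero (fun _ => simpleIntegral_nonneg fun _ => abs_nonneg _) (fun p => ?_) hlim
    have r₁ := finite_range_comp₂ (hf.finite p.1) (hf.finite p.2) fun a b => |a - b|
    have r₂ := finite_range_comp₂ (hf'.finite p.1) (hf'.finite p.2) fun a b => |a - b|
    have r₃ := finite_range_comp₂ r₁ r₂ fun a b => a + b
    rw [← simpleIntegral_const, ← simpleIntegral_add r₁ r₂, ← simpleIntegral_smul r₃,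
      ← simpleIntegral_add (finite_range_comp r₃ fun a => C * a) finite_range_const]
    exact simpleIntegral_mono (finite_range_comp₂ (hg _) (hg _) fun a b => |a - b|)
      (finite_range_comp₂ r₃ finite_range_const fun a b => C * a + b) fun z => hgg _ _ z

theorem Determines.of_uniform {g : ℕ → X → ℝ} {k : X → ℝ} (hg : ∀ n, (range (g n)).Finite)
    {e : ℕ → ℝ} (he : Tendsto e atTop (𝓝 0)) (hgk : ∀ n z, |g n z - k z| ≤ e n) :
    Determines m g k := by
  have h0 : Determines m (fun _ _ => 0) fun _ => 0 := by
    refine ⟨fun _ => finite_range_const, fun η hη => ?_, ?_⟩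
    · simp [hη.not_gt]
    · simp [simpleIntegral_const]
  refine h0.of_le h0 hg one_pos he (fun n z => ?_) fun p q z => ?_
  · simpa using hgk n z
  · have := abs_sub_le (g p z) (k z) (g q z)
    rw [abs_sub_comm (k z)] at this
    simpa using this.trans (add_le_add (hgk p z) (hgk q z))

/-- Convergence in measure to `0` and the Cauchy property give convergence to `0` in mean. This is
the reason why the integral does not depend on the determining sequence. -/
theorem Determines.abs_tendsto_zero {g : ℕ → X → ℝ} (hg : Determines m g fun _ => 0) :
    Tendsto (fun n => simpleIntegral m fun z => |g n z|) atTop (𝓝 0) := by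
  have habs : ∀ n, (range fun z => |g n z|).Finite := fun n => finite_range_comp (hg.finite n) abs
  rw [Metric.tendsto_atTop]
  intro ε hε
  obtain ⟨⟨N₁, N₂⟩, hN⟩ := (Metric.tendsto_atTop.1 hg.cauchy) (ε / 4) (by positivity)
  set N := max N₁ N₂
  -- `C` bounds the fixed function `g N`, which controls `g n` in mean for all `n ≥ N`.
  obtain ⟨C, hC⟩ := (habs N).bddAbove
  have hC0 : 0 ≤ |C| + 1 := by positivity
  -- `mass m + 1` rather than `mass m`, which may vanish
  set η := ε / (4 * (mass m + 1))
  have hm := mass_nonneg m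
  have hη : 0 < η := by positivity
  have hηm : η * mass m ≤ ε / 4 := by
    have : η * (mass m + 1) = ε / 4 := by simp only [η]; field_simp
    nlinarith
  have hsmall := hg.inMeasure η hη
  obtain ⟨M, hM⟩ := (Metric.tendsto_atTop.1 hsmall) (ε / (4 * (|C| + 1))) (by positivity)
  refine ⟨max N M, fun n hn => ?_⟩
  have hnN := hN (n, N) ⟨(le_max_left _ _).trans ((le_max_left N M).trans hn), le_max_right _ _⟩
  have hnM := hM n ((le_max_right _ _).trans hn)
  rw [Real.dist_eq, sub_zero, abs_of_nonneg] at hnN hnM ⊢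
  rotate_left
  · exact simpleIntegral_nonneg fun _ => abs_nonneg _
  · exact NNReal.coe_nonneg _
  · exact simpleIntegral_nonneg fun _ => abs_nonneg _
  simp only [sub_zero] at hnM
  set E := {z | η < |g n z|}
  have rd := finite_range_comp₂ (hg.finite n) (hg.finite N) fun a b => |a - b|
  have rE := finite_range_indicator E
  -- On `E`, `|g n| ≤ |g n - g N| + C`; off `E`, `|g n| ≤ η`.
  have hle : simpleIntegral m (fun z => |g n z|) ≤
      simpleIntegral m (fun z => |g n z - g N z|) + ((|C| + 1) * m E + η * mass m) := by
    rw [← simpleIntegral_const, ← simpleIntegral_indicator, ← simpleIntegral_smul rE,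
      ← simpleIntegral_add (finite_range_comp rE fun a => (|C| + 1) * a) finite_range_const,
      ← simpleIntegral_add rd
        (finite_range_comp₂ rE finite_range_const fun a b => (|C| + 1) * a + b)]
    refine simpleIntegral_mono (habs n) (finite_range_comp₂ rd (finite_range_comp₂ rE
      finite_range_const fun a b => (|C| + 1) * a + b) fun a b => a + b) fun z => ?_
    have h₁ := abs_nonneg (g n z - g N z)
    by_cases hz : z ∈ E
    · have h₂ : |g N z| ≤ C := hC (mem_range_self z)
      have h₃ := abs_sub_abs_le_abs_sub (g n z) (g N z)
      have h₄ := le_abs_self C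
      simp only [indicator_of_mem hz, mul_one]
      linarith
    · have h₂ : |g n z| ≤ η := not_lt.1 hz
      simp only [indicator_of_notMem hz, mul_zero, zero_add]
      linarith
  have hE : (|C| + 1) * m E ≤ ε / 4 := by
    calc (|C| + 1) * (m E : ℝ) ≤ (|C| + 1) * (ε / (4 * (|C| + 1))) :=
          mul_le_mul_of_nonneg_left hnM.le hC0
      _ = ε / 4 := by field_simp
  linarith

theorem HasIntegral.unique {h : X → ℝ} {c c' : ℝ} (hc : HasIntegral m h c)
    (hc' : HasIntegral m h c') : c = c' := by
  obtain ⟨f, hf, hfc⟩ := hc.exists_determines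
  obtain ⟨f', hf', hfc'⟩ := hc'.exists_determines
  have hd : Determines m (fun n z => f n z - f' n z) fun _ => 0 := by
    refine hf.of_le hf' (fun n => finite_range_comp₂ (hf.finite n) (hf'.finite n) fun a b => a - b)
      one_pos tendsto_const_nhds (fun n z => ?_) fun p q z => ?_
    · have := abs_sub (f n z - h z) (f' n z - h z)
      simp only [sub_sub_sub_cancel_right] at this
      simpa using this
    · have := abs_sub (f p z - f q z) (f' p z - f' q z)
      rw [sub_sub_sub_comm] at this
      simpa using this
  have hz : Tendsto (fun n => simpleIntegral m (f n) - simpleIntegral m (f' n)) atTop (𝓝 0) := by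
    refine squeeze_zero_norm (fun n => ?_) hd.abs_tendsto_zero
    rw [Real.norm_eq_abs, ← simpleIntegral_sub (hf.finite n) (hf'.finite n)]
    exact abs_simpleIntegral_le (hd.finite n)
  exact sub_eq_zero.1 (tendsto_nhds_unique (hfc.sub hfc') hz)

theorem HasIntegral.add {h h' : X → ℝ} {c c' : ℝ} (hc : HasIntegral m h c)
    (hc' : HasIntegral m h' c') : HasIntegral m (fun z => h z + h' z) (c + c') := by
  obtain ⟨f, hf, hfc⟩ := hc.exists_determines
  obtain ⟨f', hf', hfc'⟩ := hc'.exists_determines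
  refine (hf.of_le hf' (g := fun n z => f n z + f' n z) (fun n => finite_range_comp₂ (hf.finite n)
    (hf'.finite n) fun a b => a + b) one_pos tendsto_const_nhds (fun n z => ?_)
    fun p q z => ?_).hasIntegral ?_
  · simpa [add_sub_add_comm] using abs_add_le (f n z - h z) (f' n z - h' z)
  · simpa [add_sub_add_comm] using abs_add_le (f p z - f q z) (f' p z - f' q z)
  · simpa only [simpleIntegral_add (hf.finite _) (hf'.finite _)] using hfc.add hfc'

theorem HasIntegral.smul {h : X → ℝ} {c : ℝ} (hc : HasIntegral m h c) (a : ℝ) :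
    HasIntegral m (fun z => a * h z) (a * c) := by
  obtain ⟨f, hf, hfc⟩ := hc.exists_determines
  have hle : ∀ s t : ℝ, |a * s - a * t| ≤ (|a| + 1) * (|s - t| + |s - t|) := fun s t => by
    rw [← mul_sub, abs_mul]
    nlinarith [abs_nonneg a, abs_nonneg (s - t), mul_nonneg (abs_nonneg a) (abs_nonneg (s - t))]
  refine (hf.of_le hf (g := fun n z => a * f n z) (fun n => finite_range_comp (hf.finite n)
    fun s => a * s) (C := |a| + 1) (by positivity) tendsto_const_nhds (fun n z => ?_)
    fun p q z => ?_).hasIntegral ?_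
  · simpa using hle (f n z) (h z)
  · simpa using hle (f p z) (f q z)
  · simpa only [simpleIntegral_smul (hf.finite _)] using hfc.const_mul a

theorem HasIntegral.sub {h h' : X → ℝ} {c c' : ℝ} (hc : HasIntegral m h c)
    (hc' : HasIntegral m h' c') : HasIntegral m (fun z => h z - h' z) (c - c') := by
  simpa only [neg_one_mul, ← sub_eq_add_neg] using hc.add (hc'.smul (-1))

theorem hasIntegral_simple {f : X → ℝ} (hf : (range f).Finite) :
    HasIntegral m f (simpleIntegral m f) :=
  (Determines.of_uniform (g := fun _ => f) (fun _ => hf) (tendsto_const_nhds (x := (0 : ℝ)))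
    fun _ _ => by simp).hasIntegral tendsto_const_nhds

theorem hasIntegral_indicator (E : Set X) : HasIntegral m (E.indicator fun _ => 1) (m E) := by
  simpa only [simpleIntegral_indicator] using
    hasIntegral_simple (m := m) (finite_range_indicator E)

theorem hasIntegral_const (a : ℝ) : HasIntegral m (fun _ => a) (a * mass m) := by
  simpa only [simpleIntegral_const] using
    hasIntegral_simple (m := m) (finite_range_const (c := a))

theorem HasIntegral.sum {ι : Type*} {s : Finset ι} {h : ι → X → ℝ} {c : ι → ℝ}
    (hc : ∀ i ∈ s, HasIntegral m (h i) (c i)) :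
    HasIntegral m (fun z => ∑ i ∈ s, h i z) (∑ i ∈ s, c i) := by
  classical
  induction s using Finset.induction with
  | empty => simpa using hasIntegral_const (m := m) 0
  | insert i s hi ih =>
    simp only [Finset.sum_insert hi]
    exact (hc i (Finset.mem_insert_self i s)).add
      (ih fun j hj => hc j (Finset.mem_insert_of_mem hj))

/-- `|h|` is integrable together with `h`; its integral is the limit of the integrals of absolute
values of a determining sequence. -/
theorem HasIntegral.abs {h : X → ℝ} {c : ℝ} (hc : HasIntegral m h c) :
    ∃ c', HasIntegral m (fun z => |h z|) c' ∧ |c| ≤ c' := by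
  obtain ⟨f, hf, hfc⟩ := hc.exists_determines
  have hle : ∀ s t : ℝ, |(|s| - |t|)| ≤ |s - t| + |s - t| := fun s t =>
    (abs_abs_sub_abs_le_abs_sub s t).trans (le_add_of_nonneg_right (abs_nonneg _))
  have hd : Determines m (fun n z => |f n z|) fun z => |h z| := by
    refine hf.of_le hf (fun n => finite_range_comp (hf.finite n) _) one_pos tendsto_const_nhds
      (fun n z => ?_) fun p q z => ?_
    · simpa using hle (f n z) (h z)
    · simpa using hle (f p z) (f q z)
  obtain ⟨c', hc'⟩ := hd.exists_tendsto
  exact ⟨c', hd.hasIntegral hc', le_of_tendsto_of_tendsto' hfc.abs hc' fun n =>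
    abs_simpleIntegral_le (hf.finite n)⟩

theorem HasIntegral.nonneg {h : X → ℝ} {c : ℝ} (hc : HasIntegral m h c) (h0 : ∀ z, 0 ≤ h z) :
    0 ≤ c := by
  obtain ⟨c', hc', hle⟩ := hc.abs
  simp only [abs_of_nonneg (h0 _)] at hc'
  rw [hc.unique hc']
  exact (abs_nonneg c).trans hle

theorem HasIntegral.mono {h h' : X → ℝ} {c c' : ℝ} (hc : HasIntegral m h c)
    (hc' : HasIntegral m h' c') (hle : ∀ z, h z ≤ h' z) : c ≤ c' :=
  sub_nonneg.1 ((hc'.sub hc).nonneg fun z => sub_nonneg.2 (hle z))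

/-- Integrals of functions at uniform distance at most `e`. -/
theorem HasIntegral.abs_sub_le {h h' : X → ℝ} {c c' e : ℝ} (hc : HasIntegral m h c)
    (hc' : HasIntegral m h' c') (hle : ∀ z, |h z - h' z| ≤ e) : |c - c'| ≤ e * mass m := by
  obtain ⟨d, hd, hcd⟩ := (hc.sub hc').abs
  exact hcd.trans (hd.mono (hasIntegral_const e) hle)

/-- Rounding down to multiples of `1 / (n + 1)`. -/
noncomputable def roundDown (n : ℕ) (y : ℝ) : ℝ := ⌊y * (n + 1)⌋ / (n + 1)

theorem abs_roundDown_sub_le (n : ℕ) (y : ℝ) : |roundDown n y - y| ≤ 1 / ((n : ℝ) + 1) := by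
  have hn : (0 : ℝ) < n + 1 := by positivity
  have : roundDown n y - y = (⌊y * (n + 1)⌋ - y * (n + 1)) / (n + 1) := by
    rw [roundDown]; field_simp
  rw [this, abs_div, abs_of_pos hn]
  gcongr
  rw [abs_le]
  constructor <;> linarith [Int.floor_le (y * (n + 1)), Int.lt_floor_add_one (y * (n + 1))]

theorem measurable_roundDown (n : ℕ) : Measurable (roundDown n) := by
  unfold roundDown
  have h₁ : Measurable fun y : ℝ => ⌊y * (n + 1)⌋ := by fun_prop
  have h₂ : Measurable fun k : ℤ => (k : ℝ) := measurable_from_top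
  exact (h₂.comp h₁).div_const _

theorem finite_range_roundDown {Y : Type*} {b : Y → ℝ} {C : ℝ} (hb : ∀ z, |b z| ≤ C) (n : ℕ) :
    (range fun z => roundDown n (b z)).Finite := by
  have hn : (0 : ℝ) < n + 1 := by positivity
  refine ((finite_Icc ⌊-C * (n + 1)⌋ ⌊C * (n + 1)⌋).image fun k : ℤ => (k : ℝ) / (n + 1)).subset ?_
  rintro _ ⟨z, rfl⟩
  have := abs_le.1 (hb z)
  exact ⟨_, ⟨Int.floor_le_floor (by gcongr; exact this.1),
    Int.floor_le_floor (by gcongr; exact this.2)⟩, rfl⟩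

/-- If `f` is a determining sequence for `h` and `b` is bounded, then the integral of `b * h` is
the limit of those of `b * f n`. -/
theorem Determines.hasIntegral_mul {f : ℕ → X → ℝ} {h b : X → ℝ} (hf : Determines m f h) {C : ℝ}
    (hb : ∀ z, |b z| ≤ C) {c : ℕ → ℝ} {c' : ℝ}
    (hc : ∀ n, HasIntegral m (fun z => b z * f n z) (c n)) (hcc : Tendsto c atTop (𝓝 c')) :
    HasIntegral m (fun z => b z * h z) c' := by
  set k : ℕ → X → ℝ := fun n z => roundDown n (b z * f n z)
  have he := tendsto_one_div_add_atTop_nhds_zero_nat (𝕜 := ℝ)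
  have hk : ∀ n z, |k n z - b z * f n z| ≤ 1 / ((n : ℝ) + 1) := fun n z => abs_roundDown_sub_le _ _
  have hC : 0 < |C| + 1 := by positivity
  have hmul : ∀ (z : X) (s t : ℝ), |b z * s - b z * t| ≤ (|C| + 1) * (|s - t| + |s - t|) := by
    intro z s t
    rw [← mul_sub, abs_mul]
    have h₁ : |b z| ≤ |C| + 1 := (hb z).trans ((le_abs_self C).trans (by simp))
    have h₂ := mul_le_mul_of_nonneg_right h₁ (abs_nonneg (s - t))
    nlinarith [abs_nonneg (s - t)]
  have hfin : ∀ n, (range (k n)).Finite := fun n => by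
    obtain ⟨D, hD⟩ := (finite_range_comp (hf.finite n) fun s => |s|).bddAbove
    refine finite_range_roundDown (C := |C| * D) (fun z => ?_) n
    rw [abs_mul]
    exact mul_le_mul ((hb z).trans (le_abs_self C)) (hD (mem_range_self z)) (abs_nonneg _)
      (abs_nonneg _)
  have hd : Determines m k fun z => b z * h z := by
    refine hf.of_le hf hfin hC he (fun n z => ?_) fun p q z => ?_
    · have := _root_.abs_sub_le (k n z) (b z * f n z) (b z * h z)
      linarith [hk n z, hmul z (f n z) (h z)]
    · have h₁ := _root_.abs_sub_le (k p z) (b z * f p z) (k q z)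
      have h₂ := _root_.abs_sub_le (b z * f p z) (b z * f q z) (k q z)
      have h₃ := hk q z
      rw [abs_sub_comm] at h₃
      linarith [hk p z, hmul z (f p z) (f q z)]
  refine hd.hasIntegral ?_
  have hz : Tendsto (fun n => simpleIntegral m (k n) - c n) atTop (𝓝 0) := by
    refine squeeze_zero_norm (fun n => ?_) (by simpa only [zero_mul] using he.mul_const (mass m))
    exact (hasIntegral_simple (hfin n)).abs_sub_le (hc n) (hk n)
  simpa using hz.add hcc

end DunfordSchwartz

/-! ### Densities of the slices of `x̄` -/

section Slices

theorem sum_le_slice {Ω : Type*} (x : PosBa (Ω × ℝ≥0)) (E : Set (Ω × ℝ≥0)) {F : ℕ → Set Ω}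
    (hd : Pairwise (Function.onFun Disjoint F)) (n : ℕ) :
    ∑ i ∈ Finset.range n, x (F i ×ˢ univ ∩ E) ≤ x ((⋃ i, F i) ×ˢ univ ∩ E) := by
  rw [← x.biUnion]
  · refine x.mono (iUnion₂_subset fun i _ => inter_subset_inter_left _ ?_)
    exact prod_mono (subset_iUnion F i) subset_rfl
  · intro i _ j _ hij
    exact ((hd hij).set_prod_left _ _).mono inter_subset_left inter_subset_left

variable {Ω : Type*} [MeasurableSpace Ω] {x : PosBa (Ω × ℝ≥0)}

/-- Countable additivity of `F ↦ x̄(F × ℝ₊)` is inherited by `F ↦ x̄((F × ℝ₊) ∩ E)` for each `E`: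
the defect of the latter in a countable disjoint union is at most that of the former. -/
theorem CountablyAdditiveOn.hasSum_slice (hca : CountablyAdditiveOn x (fBar Ω))
    (E : Set (Ω × ℝ≥0)) {F : ℕ → Set Ω} (hF : ∀ n, MeasurableSet (F n))
    (hd : Pairwise (Function.onFun Disjoint F)) :
    HasSum (fun n => (x (F n ×ˢ univ ∩ E) : ℝ)) (x ((⋃ n, F n) ×ˢ univ ∩ E)) := by
  have hunion : (⋃ n, F n) ×ˢ (univ : Set ℝ≥0) = ⋃ n, F n ×ˢ univ := iUnion_prod_const
  have hS := hca (fun n => F n ×ˢ univ) (fun n => ⟨F n, hF n, rfl⟩)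
    (fun i j hij => (hd hij).set_prod_left _ _)
    ⟨⋃ n, F n, MeasurableSet.iUnion hF, hunion.symm⟩
  rw [← hunion] at hS
  have hsplit : ∀ G : Set Ω, (x (G ×ˢ univ) : ℝ) = x (G ×ˢ univ ∩ E) + x (G ×ˢ univ ∩ Eᶜ) := by
    intro G
    rw [← NNReal.coe_add, ← x.union, inter_union_compl]
    exact disjoint_compl_right.mono inter_subset_right inter_subset_right
  rw [hasSum_iff_tendsto_nat_of_nonneg fun _ => NNReal.coe_nonneg _]
  have h₁ := hS.tendsto_sum_nat.const_sub (x ((⋃ n, F n) ×ˢ univ) : ℝ)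
  rw [sub_self] at h₁
  rw [← tendsto_sub_nhds_zero_iff]
  refine squeeze_zero_norm (fun n => ?_) h₁
  have h₂ : ∑ i ∈ Finset.range n, (x (F i ×ˢ univ ∩ E) : ℝ) ≤ x ((⋃ i, F i) ×ˢ univ ∩ E) := by
    exact_mod_cast sum_le_slice x E hd n
  have h₃ : ∑ i ∈ Finset.range n, (x (F i ×ˢ univ ∩ Eᶜ) : ℝ) ≤ x ((⋃ i, F i) ×ˢ univ ∩ Eᶜ) := by
    exact_mod_cast sum_le_slice x Eᶜ hd n
  rw [Real.norm_eq_abs, abs_sub_comm, abs_of_nonneg (sub_nonneg.2 h₂)]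
  simp only [hsplit, Finset.sum_add_distrib]
  linarith

/-- The measure `F ↦ x̄((F × ℝ₊) ∩ E)` on `ℱ`. -/
noncomputable def CountablyAdditiveOn.slice (hca : CountablyAdditiveOn x (fBar Ω))
    (E : Set (Ω × ℝ≥0)) : Measure Ω :=
  Measure.ofMeasurable (fun F _ => (x (F ×ˢ univ ∩ E) : ENNReal)) (by simp) <| by
    intro F hF hd
    have := hca.hasSum_slice E hF hd
    rw [NNReal.hasSum_coe, ← ENNReal.hasSum_coe] at this
    exact this.tsum_eq.symm

theorem CountablyAdditiveOn.slice_apply (hca : CountablyAdditiveOn x (fBar Ω))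
    (E : Set (Ω × ℝ≥0)) {F : Set Ω} (hF : MeasurableSet F) :
    hca.slice E F = x (F ×ˢ univ ∩ E) :=
  Measure.ofMeasurable_apply F hF

instance CountablyAdditiveOn.isFiniteMeasure_slice (hca : CountablyAdditiveOn x (fBar Ω))
    (E : Set (Ω × ℝ≥0)) : IsFiniteMeasure (hca.slice E) :=
  ⟨by rw [hca.slice_apply E MeasurableSet.univ]; exact ENNReal.coe_lt_top⟩

theorem CountablyAdditiveOn.slice_absolutelyContinuous (hca : CountablyAdditiveOn x (fBar Ω))
    (E : Set (Ω × ℝ≥0)) : hca.slice E ≪ hca.slice univ := by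
  refine Measure.AbsolutelyContinuous.mk fun F hF h0 => ?_
  rw [hca.slice_apply _ hF, ENNReal.coe_eq_zero] at h0 ⊢
  exact le_antisymm ((x.mono (inter_subset_inter_right _ (subset_univ E))).trans h0.le) bot_le

/-- The probability of the theorem is the normalization of `F ↦ x̄(F × ℝ₊)`. If that measure
vanishes, any probability will do, such as a point mass. -/
theorem CountablyAdditiveOn.exists_probability [Nonempty Ω]
    (hca : CountablyAdditiveOn x (fBar Ω)) :
    ∃ P : Measure Ω, IsProbabilityMeasure P ∧ hca.slice univ ≪ P := by
  by_cases h0 : hca.slice univ = 0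
  · exact ⟨Measure.dirac (Classical.arbitrary Ω), inferInstance,
      by rw [h0]; exact Measure.AbsolutelyContinuous.zero _⟩
  · have : NeZero (hca.slice univ) := ⟨h0⟩
    refine ⟨(hca.slice univ univ)⁻¹ • hca.slice univ, inferInstance, ?_⟩
    exact Measure.absolutelyContinuous_smul (ENNReal.inv_ne_zero.2 (measure_ne_top _ _))

theorem CountablyAdditiveOn.exists_density (hca : CountablyAdditiveOn x (fBar Ω)) {P : Measure Ω}
    [IsProbabilityMeasure P] (hP : hca.slice univ ≪ P) (E : Set (Ω × ℝ≥0)) :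
    ∃ g : Ω → ℝ, Measurable g ∧ Integrable g P ∧ (∀ ω, 0 ≤ g ω) ∧
      ∀ F, MeasurableSet F → ∫ ω in F, g ω ∂P = x (F ×ˢ univ ∩ E) := by
  refine ⟨fun ω => ((hca.slice E).rnDeriv P ω).toReal,
    (Measure.measurable_rnDeriv _ _).ennreal_toReal, Measure.integrable_toReal_rnDeriv,
    fun _ => ENNReal.toReal_nonneg, fun F hF => ?_⟩
  rw [Measure.setIntegral_toReal_rnDeriv ((hca.slice_absolutelyContinuous E).trans hP) F,
    measureReal_def, hca.slice_apply E hF, ENNReal.coe_toReal]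

/-- Converse of the existence of densities for `E = Ω × ℝ₊`. -/
theorem countablyAdditiveOn_of_density {P : Measure Ω} {g : Ω → ℝ} (hg : Integrable g P)
    (h : ∀ F, MeasurableSet F → (x (F ×ˢ univ) : ℝ) = ∫ ω in F, g ω ∂P) :
    CountablyAdditiveOn x (fBar Ω) := by
  intro S hS hd _
  choose F hF hSF using hS
  obtain rfl : S = fun n => F n ×ˢ univ := funext hSF
  have hunion : (⋃ n, F n ×ˢ univ) = (⋃ n, F n) ×ˢ (univ : Set ℝ≥0) := iUnion_prod_const.symm
  rw [hunion, h _ (MeasurableSet.iUnion hF)]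
  simp only [h _ (hF _)]
  refine hasSum_integral_iUnion hF (fun i j hij => ?_) hg.integrableOn
  have := disjoint_prod.1 (hd hij)
  simpa [univ_nonempty.ne_empty] using this

end Slices

/-! ### The operator `I_x̄` -/

section Operator

variable {Ω : Type*} [MeasurableSpace Ω] {x : PosBa (Ω × ℝ≥0)} {P : Measure Ω}

theorem integrable_bdd_mul_Lp {b : Ω → ℝ} (hb : Measurable b) (hbC : ∃ C, ∀ ω, |b ω| ≤ C)
    (g : Lp ℝ 1 P) : Integrable (fun ω => b ω * g ω) P := by
  obtain ⟨C, hC⟩ := hbC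
  exact (L1.integrable_coeFn g).bdd_mul hb.aestronglyMeasurable (Eventually.of_forall hC)

theorem Solves.add {h h' : Ω × ℝ≥0 → ℝ} {g g' : Lp ℝ 1 P} (hg : Solves x P h g)
    (hg' : Solves x P h' g') : Solves x P (fun z => h z + h' z) (g + g') := by
  intro b hb hbC
  have := (hg b hb hbC).add (hg' b hb hbC)
  rw [← integral_add (integrable_bdd_mul_Lp hb hbC g) (integrable_bdd_mul_Lp hb hbC g')] at this
  simp only [← mul_add] at this
  rwa [integral_congr_ae]
  filter_upwards [Lp.coeFn_add g g'] with ω hω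
  rw [hω, Pi.add_apply]

theorem Solves.smul {h : Ω × ℝ≥0 → ℝ} {g : Lp ℝ 1 P} (hg : Solves x P h g) (a : ℝ) :
    Solves x P (fun z => a * h z) (a • g) := by
  intro b hb hbC
  have := (hg b hb hbC).smul a
  rw [← integral_const_mul] at this
  simp only [mul_left_comm a] at this
  rwa [integral_congr_ae]
  filter_upwards [Lp.coeFn_smul a g] with ω hω
  rw [hω, Pi.smul_apply, smul_eq_mul]

theorem Solves.sub {h h' : Ω × ℝ≥0 → ℝ} {g g' : Lp ℝ 1 P} (hg : Solves x P h g)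
    (hg' : Solves x P h' g') : Solves x P (fun z => h z - h' z) (g - g') := by
  simpa only [neg_one_mul, ← sub_eq_add_neg, neg_one_smul] using hg.add (hg'.smul (-1))

/-- Contractivity of `h ↦ g`, by duality: test with `b = sign g`. -/
theorem Solves.norm_le {h : Ω × ℝ≥0 → ℝ} {g : Lp ℝ 1 P} (hg : Solves x P h g) {c : ℝ}
    (hc : HasIntegral x (fun z => |h z|) c) : ‖g‖ ≤ c := by
  have hmeas : MeasurableSet {ω | 0 ≤ g ω} :=
    measurableSet_le measurable_const (Lp.stronglyMeasurable g).measurable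
  classical
  set b : Ω → ℝ := fun ω => if 0 ≤ g ω then 1 else -1
  have hb1 : ∀ ω, |b ω| = 1 := fun ω => by simp only [b]; split_ifs <;> simp
  have hb := hg b (Measurable.ite hmeas measurable_const measurable_const)
    ⟨1, fun ω => (hb1 ω).le⟩
  have hbg : ∀ ω, b ω * g ω = ‖g ω‖ := fun ω => by
    simp only [b, Real.norm_eq_abs]
    split_ifs with h0
    · rw [one_mul, abs_of_nonneg h0]
    · rw [neg_one_mul, abs_of_neg (not_le.1 h0)]
  simp only [hbg] at hb
  rw [← L1.norm_eq_integral_norm] at hb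
  refine hb.mono hc fun z => (le_abs_self _).trans ?_
  rw [abs_mul, hb1, one_mul]

theorem Solves.hasIntegral [IsProbabilityMeasure P] {h : Ω × ℝ≥0 → ℝ} {g : Lp ℝ 1 P}
    (hg : Solves x P h g) : HasIntegral x h (∫ ω, g ω ∂P) := by
  simpa using hg (fun _ => 1) measurable_const ⟨1, fun _ => by simp⟩

theorem Solves.hasIntegral_indicator {h : Ω × ℝ≥0 → ℝ} {g : Lp ℝ 1 P}
    (hg : Solves x P h g) {F : Set Ω} (hF : MeasurableSet F) :
    HasIntegral x ((F ×ˢ univ).indicator h) (∫ ω in F, g ω ∂P) := by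
  have := hg (F.indicator fun _ => 1) (measurable_const.indicator hF)
    ⟨1, fun ω => by by_cases hω : ω ∈ F <;> simp [hω]⟩
  rw [← integral_indicator hF]
  convert this using 1
  · ext z
    by_cases hz : z.1 ∈ F <;> simp [hz, indicator]
  · congr 1
    ext ω
    by_cases hω : ω ∈ F <;> simp [hω]

theorem Solves.unique {h : Ω × ℝ≥0 → ℝ} {g g' : Lp ℝ 1 P} (hg : Solves x P h g)
    (hg' : Solves x P h g') : g = g' := by
  have h0 := hg.sub hg'
  have hc : HasIntegral x (fun z => |h z - h z|) 0 := by
    simpa using hasIntegral_const (m := x) 0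
  exact sub_eq_zero.1 (norm_le_zero_iff.1 (h0.norm_le hc))

theorem solves_toL1 {h : Ω × ℝ≥0 → ℝ} {g : Ω → ℝ} (hgi : Integrable g P)
    (hg : ∀ b : Ω → ℝ, Measurable b → (∃ C, ∀ ω, |b ω| ≤ C) →
      HasIntegral x (fun z => b z.1 * h z) (∫ ω, b ω * g ω ∂P)) :
    Solves x P h (hgi.toL1 g) := by
  intro b hb hbC
  rw [integral_congr_ae (g := fun ω => b ω * g ω)]
  · exact hg b hb hbC
  · filter_upwards [hgi.coeFn_toL1] with ω hω
    rw [hω]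

/-- The case of a simple `b` in `x̄(b 1_E) = P(b g)`. -/
theorem hasIntegral_finite_range_mul_indicator {E : Set (Ω × ℝ≥0)} {g : Ω → ℝ}
    (hgi : Integrable g P) (hg : ∀ F, MeasurableSet F → ∫ ω in F, g ω ∂P = x (F ×ˢ univ ∩ E))
    {b : Ω → ℝ} (hb : Measurable b) (hfin : (range b).Finite) :
    HasIntegral x (fun z => b z.1 * E.indicator (fun _ => 1) z) (∫ ω, b ω * g ω ∂P) := by
  have hpart : ∀ ω, ∑ y ∈ hfin.toFinset, y * (b ⁻¹' {y}).indicator (fun _ => (1 : ℝ)) ω = b ω := by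
    intro ω
    rw [Finset.sum_eq_single (b ω)]
    · simp
    · intro y _ hy
      simp [hy.symm]
    · intro hn
      exact absurd (hfin.mem_toFinset.2 (mem_range_self ω)) hn
  have hF : ∀ y, MeasurableSet (b ⁻¹' {y}) := fun y => hb (measurableSet_singleton y)
  have hsum := HasIntegral.sum (m := x) (s := hfin.toFinset)
    (h := fun y z => y * ((b ⁻¹' {y}) ×ˢ univ ∩ E).indicator (fun _ => 1) z)
    fun y _ => (hasIntegral_indicator ((b ⁻¹' {y}) ×ˢ univ ∩ E)).smul y
  convert hsum using 1
  · ext z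
    rw [← hpart z.1, Finset.sum_mul]
    refine Finset.sum_congr rfl fun y _ => ?_
    by_cases h₁ : z ∈ E <;> by_cases h₂ : b z.1 = y <;> simp [indicator, h₁, h₂]
  · have hint : ∀ y, Integrable (fun ω => y * (b ⁻¹' {y}).indicator g ω) P := fun y =>
      (hgi.indicator (hF y)).const_mul y
    have hval : ∀ y, y * (x ((b ⁻¹' {y}) ×ˢ univ ∩ E) : ℝ) =
        ∫ ω, y * (b ⁻¹' {y}).indicator g ω ∂P := fun y => by
      rw [← hg _ (hF y), integral_const_mul, integral_indicator (hF y)]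
    simp only [hval]
    rw [← integral_finsetSum _ fun y _ => hint y]
    congr 1
    ext ω
    rw [← hpart ω, Finset.sum_mul]
    refine Finset.sum_congr rfl fun y _ => ?_
    by_cases h₂ : b ω = y <;> simp [indicator, h₂]

/-- A density of `F ↦ x̄((F × ℝ₊) ∩ E)` solves the equation for `h = 1_E`: this holds for simple
`b`, and then for bounded `b` by uniform approximation. -/
theorem solves_indicator {E : Set (Ω × ℝ≥0)} {g : Ω → ℝ} (hgi : Integrable g P)
    (hg : ∀ F, MeasurableSet F → ∫ ω in F, g ω ∂P = x (F ×ˢ univ ∩ E)) :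
    Solves x P (E.indicator fun _ => 1) (hgi.toL1 g) := by
  refine solves_toL1 hgi fun b hb hbC => ?_
  obtain ⟨C, hC⟩ := hbC
  have he := tendsto_one_div_add_atTop_nhds_zero_nat (𝕜 := ℝ)
  have hfin : ∀ n, (range fun ω => roundDown n (b ω)).Finite := finite_range_roundDown hC
  have hmeas : ∀ n, Measurable fun ω => roundDown n (b ω) := fun n =>
    (measurable_roundDown n).comp hb
  have hfin' : ∀ n, (range fun z : Ω × ℝ≥0 =>
      roundDown n (b z.1) * E.indicator (fun _ => 1) z).Finite := fun n =>
    finite_range_comp₂ (f := fun z : Ω × ℝ≥0 => roundDown n (b z.1))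
      (finite_range_roundDown (fun z : Ω × ℝ≥0 => hC z.1) n) (finite_range_indicator E)
      fun s t => s * t
  have hd : Determines x (fun n z => roundDown n (b z.1) * E.indicator (fun _ => 1) z)
      fun z => b z.1 * E.indicator (fun _ => 1) z := by
    refine Determines.of_uniform hfin' he fun n z => ?_
    rw [← sub_mul, abs_mul]
    refine (mul_le_of_le_one_right (abs_nonneg _) ?_).trans (abs_roundDown_sub_le n (b z.1))
    by_cases hz : z ∈ E <;> simp [hz]
  refine hd.hasIntegral ?_
  have hval : ∀ n, simpleIntegral x (fun z => roundDown n (b z.1) * E.indicator (fun _ => 1) z) =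
      ∫ ω, roundDown n (b ω) * g ω ∂P := fun n => (hasIntegral_simple (hfin' n)).unique
    (hasIntegral_finite_range_mul_indicator (b := fun ω => roundDown n (b ω)) hgi hg (hmeas n)
      (hfin n))
  simp only [hval]
  have hint : ∀ n, Integrable (fun ω => roundDown n (b ω) * g ω) P := fun n => by
    obtain ⟨D, hD⟩ := (finite_range_comp (hfin n) fun s => |s|).bddAbove
    exact hgi.bdd_mul (hmeas n).aestronglyMeasurable
      (Eventually.of_forall fun ω => hD (mem_range_self ω))
  have hintb : Integrable (fun ω => b ω * g ω) P :=
    hgi.bdd_mul hb.aestronglyMeasurable (Eventually.of_forall hC)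
  rw [← tendsto_sub_nhds_zero_iff]
  have hlim := he.mul_const (∫ ω, ‖g ω‖ ∂P)
  rw [zero_mul] at hlim
  refine squeeze_zero_norm (fun n => ?_) hlim
  rw [← integral_sub (hint n) hintb, ← integral_const_mul]
  refine norm_integral_le_of_norm_le (hgi.norm.const_mul _) (Eventually.of_forall fun ω => ?_)
  rw [← sub_mul, norm_mul]
  exact mul_le_mul_of_nonneg_right (abs_roundDown_sub_le n (b ω)) (norm_nonneg _)

theorem CountablyAdditiveOn.exists_solves_of_finite_range [IsProbabilityMeasure P]
    (hca : CountablyAdditiveOn x (fBar Ω)) (hP : hca.slice univ ≪ P) {f : Ω × ℝ≥0 → ℝ}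
    (hf : (range f).Finite) : ∃ g : Lp ℝ 1 P, Solves x P f g := by
  have hE : ∀ E : Set (Ω × ℝ≥0), ∃ g : Lp ℝ 1 P, Solves x P (E.indicator fun _ => 1) g := by
    intro E
    obtain ⟨g, _, hgi, _, hg⟩ := hca.exists_density hP E
    exact ⟨_, solves_indicator hgi hg⟩
  have hsum : ∀ s : Finset ℝ, ∃ g : Lp ℝ 1 P,
      Solves x P (fun z => ∑ y ∈ s, y * (f ⁻¹' {y}).indicator (fun _ => 1) z) g := by
    intro s
    induction s using Finset.induction with
    | empty =>
      obtain ⟨g, hg⟩ := hE ∅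
      exact ⟨g, by simpa using hg⟩
    | insert y s hy ih =>
      obtain ⟨g, hg⟩ := ih
      obtain ⟨g', hg'⟩ := hE (f ⁻¹' {y})
      simp only [Finset.sum_insert hy]
      exact ⟨_, (hg'.smul y).add hg⟩
  obtain ⟨g, hg⟩ := hsum hf.toFinset
  refine ⟨g, ?_⟩
  convert hg using 1
  ext z
  rw [Finset.sum_eq_single (f z)]
  · simp
  · intro y _ hy
    simp [hy.symm]
  · intro hn
    exact absurd (hf.mem_toFinset.2 (mem_range_self z)) hn

/-- The solutions for a determining sequence are Cauchy in `L¹(P)`, by contractivity; their limit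
is the solution for `h`. -/
theorem CountablyAdditiveOn.exists_solves [IsProbabilityMeasure P]
    (hca : CountablyAdditiveOn x (fBar Ω)) (hP : hca.slice univ ≪ P) {h : Ω × ℝ≥0 → ℝ}
    (hh : MemL1 x h) : ∃ g : Lp ℝ 1 P, Solves x P h g := by
  obtain ⟨c, hc⟩ := hh
  obtain ⟨f, hf, -⟩ := hc.exists_determines
  choose g hg using fun n => hca.exists_solves_of_finite_range hP (hf.finite n)
  have hcauchy : CauchySeq g := by
    rw [cauchySeq_iff_tendsto_dist_atTop_0]
    refine squeeze_zero (fun _ => dist_nonneg) (fun p => ?_) hf.cauchy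
    rw [dist_eq_norm]
    exact ((hg p.1).sub (hg p.2)).norm_le (hasIntegral_simple
      (finite_range_comp₂ (hf.finite _) (hf.finite _) fun a b => |a - b|))
  obtain ⟨G, hG⟩ := cauchySeq_tendsto_of_complete hcauchy
  refine ⟨G, fun b hb hbC => ?_⟩
  obtain ⟨C, hC⟩ := hbC
  refine hf.hasIntegral_mul (b := fun z => b z.1) (c := fun n => ∫ ω, b ω * g n ω ∂P)
    (fun z => hC z.1) (fun n => hg n b hb ⟨C, hC⟩) ?_
  rw [← tendsto_sub_nhds_zero_iff]
  have hlim := (tendsto_iff_norm_sub_tendsto_zero.1 hG).const_mul C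
  rw [mul_zero] at hlim
  refine squeeze_zero_norm (fun n => ?_) hlim
  rw [← integral_sub (integrable_bdd_mul_Lp hb ⟨C, hC⟩ _) (integrable_bdd_mul_Lp hb ⟨C, hC⟩ _),
    L1.norm_eq_integral_norm, ← integral_const_mul]
  refine norm_integral_le_of_norm_le ((L1.integrable_coeFn _).norm.const_mul _) ?_
  filter_upwards [Lp.coeFn_sub (g n) G] with ω hω
  rw [hω, ← mul_sub, norm_mul, Pi.sub_apply]
  exact mul_le_mul_of_nonneg_right (hC ω) (norm_nonneg _)

end Operator

/-! ### Properties of the operator -/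

section Properties

variable {Ω : Type*} [MeasurableSpace Ω] {x : PosBa (Ω × ℝ≥0)} {P : Measure Ω}

theorem CountablyAdditiveOn.exists_isIntegralOperator [IsProbabilityMeasure P]
    (hca : CountablyAdditiveOn x (fBar Ω)) (hP : hca.slice univ ≪ P)
    (h0 : x (univ ×ˢ {0}) = 0) :
    ∃ I : (Ω × ℝ≥0 → ℝ) → Lp ℝ 1 P, IsIntegralOperator x P I := by
  classical
  have hI : ∀ h, ∃ g : Lp ℝ 1 P, MemL1 x h → Solves x P h g := fun h => by
    by_cases hh : MemL1 x h
    · obtain ⟨g, hg⟩ := hca.exists_solves hP hh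
      exact ⟨g, fun _ => hg⟩
    · exact ⟨0, fun hh' => absurd hh' hh⟩
  choose I hI using hI
  refine ⟨I, hI, fun h hh g hg => hg.unique (hI h hh), ?_⟩
  have hE := hasIntegral_indicator (m := x) (univ ×ˢ {0})
  have habs : HasIntegral x
      (fun z => |(univ ×ˢ {0} : Set (Ω × ℝ≥0)).indicator (fun _ => (1 : ℝ)) z|) 0 := by
    rw [h0, NNReal.coe_zero] at hE
    refine Eq.mp ?_ hE
    congr 1
    ext z
    exact (abs_of_nonneg (indicator_nonneg (fun _ _ => zero_le_one) z)).symm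
  exact norm_le_zero_iff.1 ((hI _ ⟨_, hE⟩).norm_le habs)

theorem IsIntegralOperator.countablyAdditiveOn {I : (Ω × ℝ≥0 → ℝ) → Lp ℝ 1 P}
    (hI : IsIntegralOperator x P I) : CountablyAdditiveOn x (fBar Ω) := by
  refine countablyAdditiveOn_of_density (L1.integrable_coeFn (I fun _ => 1)) fun F hF => ?_
  exact (hasIntegral_indicator _).unique
    ((hI.solves _ ⟨_, hasIntegral_const 1⟩).hasIntegral_indicator hF)

theorem IsIntegralOperator.apply_zero_section [IsProbabilityMeasure P]
    {I : (Ω × ℝ≥0 → ℝ) → Lp ℝ 1 P} (hI : IsIntegralOperator x P I) :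
    x (univ ×ˢ {0}) = 0 := by
  have hE := hasIntegral_indicator (m := x) (univ ×ˢ {0})
  have h := (hI.solves _ ⟨_, hE⟩).hasIntegral
  rw [hI.zero, integral_congr_ae (Lp.coeFn_zero ℝ 1 P)] at h
  simpa using hE.unique h

theorem Solves.nonneg {h : Ω × ℝ≥0 → ℝ} {g : Lp ℝ 1 P} (hg : Solves x P h g)
    (h0 : ∀ z, 0 ≤ h z) : 0 ≤ g := by
  rw [← Lp.coeFn_nonneg]
  refine ae_nonneg_of_forall_setIntegral_nonneg (L1.integrable_coeFn g) fun F hF _ => ?_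
  exact (hg.hasIntegral_indicator hF).nonneg (indicator_nonneg fun z _ => h0 z)

theorem Solves.norm_eq [IsProbabilityMeasure P] {h : Ω × ℝ≥0 → ℝ} {g : Lp ℝ 1 P}
    (hg : Solves x P h g) (h0 : ∀ z, 0 ≤ h z) {c : ℝ} (hc : HasIntegral x h c) : ‖g‖ = c := by
  have hpos := (Lp.coeFn_nonneg g).2 (hg.nonneg h0)
  rw [L1.norm_eq_integral_norm, hc.unique hg.hasIntegral]
  refine integral_congr_ae ?_
  filter_upwards [hpos] with ω hω
  exact Real.norm_of_nonneg hω

theorem IsIntegralOperator.isLUB_norm [IsProbabilityMeasure P] {I : (Ω × ℝ≥0 → ℝ) → Lp ℝ 1 P}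
    (hI : IsIntegralOperator x P I) :
    IsLUB {r : ℝ | ∃ h, MemL1 x h ∧ (∀ z, |h z| ≤ 1) ∧ r = ‖I h‖} (mass x) := by
  have h1 : HasIntegral x (fun _ => 1) (mass x) := by simpa using hasIntegral_const (m := x) 1
  constructor
  · rintro _ ⟨h, hh, hle, rfl⟩
    have hS := hI.solves h hh
    obtain ⟨c, hc⟩ := hh
    obtain ⟨c', hc', -⟩ := hc.abs
    exact (hS.norm_le hc').trans (hc'.mono h1 hle)
  · intro r hr
    refine hr ⟨fun _ => 1, ⟨_, h1⟩, fun _ => by simp, ?_⟩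
    exact ((hI.solves _ ⟨_, h1⟩).norm_eq (fun _ => zero_le_one) h1).symm

/-- Off a measurable set `F × ℝ₊` with `P F` small, `|h n| ≤ η`; on it, `|h n|` is at most the
dominating function `s`, whose integral there is `∫_F I s dP`. -/
theorem IsIntegralOperator.dominated_convergence [IsProbabilityMeasure P]
    {I : (Ω × ℝ≥0 → ℝ) → Lp ℝ 1 P} (hI : IsIntegralOperator x P I) {h : ℕ → Ω × ℝ≥0 → ℝ}
    (hh : ∀ n, MemL1 x (h n)) {s : Ω × ℝ≥0 → ℝ} (hs : MemL1 x s) (hle : ∀ n z, |h n z| ≤ s z)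
    (hlim : ∀ η : ℝ, 0 < η →
      Tendsto (fun n => P {ω | ∃ t, η < |h n (ω, t)|}) atTop (𝓝 0)) :
    Tendsto (fun n => I (h n)) atTop (𝓝 0) := by
  have hbound : ∀ η : ℝ, 0 < η → ∀ n, ‖I (h n)‖ ≤
      η * mass x + ∫ ω in toMeasurable P {ω | ∃ t, η < |h n (ω, t)|}, I s ω ∂P := by
    intro η hη n
    have hS := hI.solves _ (hh n)
    obtain ⟨c, hc⟩ := hh n
    obtain ⟨c', hc', -⟩ := hc.abs
    refine (hS.norm_le hc').trans (hc'.mono ((hasIntegral_const η).add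
      ((hI.solves s hs).hasIntegral_indicator (measurableSet_toMeasurable P _))) fun z => ?_)
    have hs0 : 0 ≤ s z := (abs_nonneg _).trans (hle n z)
    by_cases hz : z.1 ∈ toMeasurable P {ω | ∃ t, η < |h n (ω, t)|}
    · rw [indicator_of_mem (mk_mem_prod hz (mem_univ z.2))]
      linarith [hle n z]
    · have hz' : z.1 ∉ {ω | ∃ t, η < |h n (ω, t)|} := fun hmem =>
        hz (subset_toMeasurable P _ hmem)
      rw [indicator_of_notMem (fun hmem => hz hmem.1), add_zero]
      exact not_lt.1 fun hlt => hz' ⟨z.2, hlt⟩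
  rw [tendsto_zero_iff_norm_tendsto_zero, Metric.tendsto_atTop]
  intro ε hε
  have hm := mass_nonneg x
  set η := ε / (2 * (mass x + 1))
  have hη : 0 < η := by positivity
  have hηm : η * mass x ≤ ε / 2 := by
    have : η * (mass x + 1) = ε / 2 := by simp only [η]; field_simp
    nlinarith
  have htail : Tendsto (fun n => ∫ ω in toMeasurable P {ω | ∃ t, η < |h n (ω, t)|}, I s ω ∂P)
      atTop (𝓝 0) := by
    refine (L1.integrable_coeFn (I s)).tendsto_setIntegral_nhds_zero ?_
    simpa only [Function.comp_def, measure_toMeasurable] using hlim η hη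
  obtain ⟨N, hN⟩ := (Metric.tendsto_atTop.1 htail) (ε / 2) (half_pos hε)
  refine ⟨N, fun n hn => ?_⟩
  have h₁ := hN n hn
  rw [Real.dist_eq, sub_zero] at h₁
  have h₂ := (abs_lt.1 h₁).2
  rw [Real.dist_eq, sub_zero, abs_norm]
  linarith [hbound η hη n]

end Properties

/-! ### Increasing processes -/

section Processes

variable {Ω : Type*} {x : PosBa (Ω × ℝ≥0)}

/-- The set `F × {0}`. -/
def RectUnion.atZero {𝒞 : Set (Set Ω)} {F : Set Ω} (hF : F ∈ 𝒞) : RectUnion 𝒞 where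
  N := 0
  F₀ := F
  F := Fin.elim0
  s := Fin.elim0
  u := Fin.elim0
  F₀_mem := hF
  F_mem n := n.elim0
  s_le_u n := n.elim0
  disj n := n.elim0

/-- The set `F × ]0, t]`. -/
def RectUnion.single {𝒞 : Set (Set Ω)} (h0 : ∅ ∈ 𝒞) {F : Set Ω} (hF : F ∈ 𝒞) (t : ℝ≥0) :
    RectUnion 𝒞 where
  N := 1
  F₀ := ∅
  F _ := F
  s _ := 0
  u _ := t
  F₀_mem := h0
  F_mem _ := hF
  s_le_u _ := zero_le
  disj i j hij := absurd (Subsingleton.elim i j) hij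

/-- As `x̄` does not charge `Ω × {0}`, only the rectangles `Fₙ × ]sₙ, uₙ]` contribute. -/
theorem RectUnion.apply_carrier {𝒞 : Set (Set Ω)} (H : RectUnion 𝒞)
    (h0 : x (univ ×ˢ {0}) = 0) :
    x H.carrier = ∑ n, x (H.F n ×ˢ Ioc (H.s n) (H.u n)) := by
  have hz : x (H.F₀ ×ˢ {0}) = 0 :=
    le_antisymm ((x.mono (prod_mono (subset_univ _) subset_rfl)).trans h0.le) bot_le
  rw [RectUnion.carrier, x.union, hz, zero_add]
  · have := x.biUnion Finset.univ (fun n => H.F n ×ˢ Ioc (H.s n) (H.u n))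
      (H.disj.set_pairwise _)
    simpa using this
  · rw [disjoint_iUnion_right]
    intro n
    refine disjoint_prod.2 (Or.inr ?_)
    simp

theorem prod_split (F : Set Ω) (t : ℝ≥0) :
    x (F ×ˢ univ) = x (F ×ˢ Iic t) + x (F ×ˢ Ioi t) := by
  rw [← x.union, ← prod_union, Iic_union_Ioi]
  exact disjoint_prod.2 (Or.inr (Iic_disjoint_Ioi le_rfl))

theorem prod_Iic_split (F : Set Ω) {s t : ℝ≥0} (hst : s ≤ t) :
    x (F ×ˢ Iic t) = x (F ×ˢ Iic s) + x (F ×ˢ Ioc s t) := by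
  rw [← x.union, ← prod_union, Iic_union_Ioc_eq_Iic hst]
  exact disjoint_prod.2 (Or.inr (Iic_disjoint_Ioc le_rfl))

theorem IsDoleans.tendsto_Iic (hx : IsDoleans x) (F : Set Ω) :
    Tendsto (fun n : ℕ => (x (F ×ˢ Iic (n : ℝ≥0)) : ℝ)) atTop (𝓝 (x (F ×ˢ univ))) := by
  have h₁ : Tendsto (fun n : ℕ => (x (F ×ˢ Ioi (n : ℝ≥0)) : ℝ)) atTop (𝓝 0) := by
    refine squeeze_zero (fun _ => NNReal.coe_nonneg _) (fun n => ?_)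
      (hx.comp tendsto_natCast_atTop_atTop)
    exact_mod_cast x.mono (prod_mono (subset_univ _) subset_rfl)
  have h₂ := h₁.const_sub (x (F ×ˢ univ) : ℝ)
  rw [sub_zero] at h₂
  refine h₂.congr fun n => ?_
  rw [prod_split F (n : ℝ≥0), NNReal.coe_add, add_sub_cancel_right]

variable [MeasurableSpace Ω] {P : Measure Ω} {A : ℝ≥0 → Ω → ℝ}

theorem IsIncreasing.ae_le_infty (hA : IsIncreasing P A) {A' : Ω → ℝ}
    (hlim : ∀ᵐ ω ∂P, Tendsto (fun n : ℕ => A n ω) atTop (𝓝 (A' ω))) (t : ℝ≥0) :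
    ∀ᵐ ω ∂P, A 0 ω = 0 ∧ 0 ≤ A t ω ∧ A t ω ≤ A' ω := by
  have hmono : ∀ᵐ ω ∂P, ∀ n : ℕ, t ≤ n → A 0 ω = 0 ∧ 0 ≤ A t ω ∧ A t ω ≤ A n ω :=
    ae_all_iff.2 fun n => by
      by_cases hn : t ≤ n
      · filter_upwards [hA.mono t n hn] with ω hω _ using hω
      · exact Eventually.of_forall fun ω hn' => absurd hn' hn
  obtain ⟨N, hN⟩ := exists_nat_ge t
  filter_upwards [hmono, hlim] with ω hω hl
  refine ⟨(hω N hN).1, (hω N hN).2.1, ge_of_tendsto hl ?_⟩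
  filter_upwards [eventually_ge_atTop N] with n hn
  exact (hω n (hN.trans (by exact_mod_cast hn))).2.2

theorem IsIncreasing.integrable (hA : IsIncreasing P A) (t : ℝ≥0) : Integrable (A t) P := by
  obtain ⟨A', hA', hlim⟩ := hA.integrable_infty
  refine hA'.mono' (hA.measurable t).aestronglyMeasurable ?_
  filter_upwards [hA.ae_le_infty hlim t] with ω hω
  rw [Real.norm_of_nonneg hω.2.1]
  exact hω.2.2

theorem Represents.apply_zero_section {𝒞 : Set (Set Ω)} (hR : Represents 𝒞 x P A) {F : Set Ω}
    (hF : F ∈ 𝒞) : x (F ×ˢ {0}) = 0 := by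
  have := hR (RectUnion.atZero hF)
  simpa [RectUnion.atZero, RectUnion.carrier, RectUnion.integral] using this

theorem Represents.apply_Ioc {𝒞 : Set (Set Ω)} (hA : IsIncreasing P A) (hR : Represents 𝒞 x P A)
    (h0 : ∅ ∈ 𝒞) {F : Set Ω} (hF : F ∈ 𝒞) (hFm : MeasurableSet F) (t : ℝ≥0) :
    (x (F ×ˢ Ioc 0 t) : ℝ) = ∫ ω in F, A t ω ∂P := by
  have hcar : (RectUnion.single h0 hF t).carrier = F ×ˢ Ioc 0 t := by
    have hU : (⋃ _ : Fin 1, F ×ˢ Ioc 0 t) = F ×ˢ Ioc 0 t := iUnion_const _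
    rw [← hU]
    exact (congrArg (· ∪ _) empty_prod).trans (empty_union _)
  have hint : (RectUnion.single h0 hF t).integral A = F.indicator fun ω => A t ω - A 0 ω :=
    funext fun ω => Fin.sum_univ_one fun _ => F.indicator (fun ω' => A t ω' - A 0 ω') ω
  rw [← hcar, hR, hint, integral_indicator hFm]
  refine integral_congr_ae (ae_restrict_of_ae ?_)
  filter_upwards [hA.mono t t le_rfl] with ω hω
  rw [hω.1, sub_zero]

/-- `A_∞` is a density of `F ↦ x̄(F × ℝ₊)`. -/
theorem Represents.countablyAdditiveOn (hx : IsDoleans x) (hA : IsIncreasing P A)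
    (hR : Represents {F | MeasurableSet F} x P A) : CountablyAdditiveOn x (fBar Ω) := by
  obtain ⟨A', hA', hlim⟩ := hA.integrable_infty
  refine countablyAdditiveOn_of_density hA' fun F hF => ?_
  have hIic : ∀ n : ℕ, (x (F ×ˢ Iic (n : ℝ≥0)) : ℝ) = ∫ ω in F, A n ω ∂P := fun n => by
    have hz : (Iic 0 : Set ℝ≥0) = {0} := Iic_bot
    rw [prod_Iic_split F (zero_le (a := (n : ℝ≥0))), hz, hR.apply_zero_section hF, zero_add]
    exact hR.apply_Ioc hA MeasurableSet.empty hF hF n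
  have h₁ := hx.tendsto_Iic F
  simp only [hIic] at h₁
  refine tendsto_nhds_unique h₁ (tendsto_integral_of_dominated_convergence A'
    (fun n => (hA.measurable n).aestronglyMeasurable) hA'.integrableOn (fun n => ?_)
    (ae_restrict_of_ae hlim))
  refine ae_restrict_of_ae ?_
  filter_upwards [hA.ae_le_infty hlim n] with ω hω
  rw [Real.norm_of_nonneg hω.2.1]
  exact hω.2.2

/-- `A_t` is the density of `F ↦ x̄(F × [0, t])`. -/
theorem CountablyAdditiveOn.exists_isIncreasing [IsProbabilityMeasure P] (hx : IsDoleans x)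
    (hca : CountablyAdditiveOn x (fBar Ω)) (hP : hca.slice univ ≪ P)
    (h0 : x (univ ×ˢ {0}) = 0) :
    ∃ A : ℝ≥0 → Ω → ℝ, IsIncreasing P A ∧ Represents {F | MeasurableSet F} x P A := by
  choose A hAm hAi hA0 hA using fun t : ℝ≥0 => hca.exists_density hP (univ ×ˢ Iic t)
  simp only [prod_inter_prod, inter_univ, univ_inter] at hA
  obtain ⟨G, hGm, hGi, hG0, hG⟩ := hca.exists_density hP univ
  simp only [inter_univ] at hG
  have hle : ∀ {f g : Ω → ℝ}, Integrable f P → Integrable g P →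
      (∀ F, MeasurableSet F → ∫ ω in F, f ω ∂P ≤ ∫ ω in F, g ω ∂P) → f ≤ᵐ[P] g :=
    fun hf hg h => ae_le_of_forall_setIntegral_le hf hg fun F hF _ => h F hF
  have hmono : ∀ t u, t ≤ u → A t ≤ᵐ[P] A u := fun t u htu => by
    refine hle (hAi t) (hAi u) fun F hF => ?_
    rw [hA t F hF, hA u F hF]
    exact_mod_cast x.mono (prod_mono subset_rfl (Iic_subset_Iic.2 htu))
  have hAG : ∀ t, A t ≤ᵐ[P] G := fun t => by
    refine hle (hAi t) hGi fun F hF => ?_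
    rw [hA t F hF, hG F hF]
    exact_mod_cast x.mono (prod_mono subset_rfl (subset_univ _))
  have hzero : A 0 ≤ᵐ[P] fun _ => 0 := by
    refine hle (hAi 0) (integrable_zero _ _ _) fun F hF => ?_
    have hz : (Iic 0 : Set ℝ≥0) = {0} := Iic_bot
    have hle0 : x (F ×ˢ {0}) ≤ 0 := (x.mono (prod_mono (subset_univ _) subset_rfl)).trans h0.le
    rw [hA 0 F hF, integral_zero, hz]
    exact_mod_cast hle0
  refine ⟨A, ⟨hAm, fun t u htu => ?_, G, hGi, ?_⟩, fun H => ?_⟩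
  · filter_upwards [hmono t u htu, hzero] with ω h₁ h₂
    exact ⟨le_antisymm h₂ (hA0 0 ω), hA0 t ω, h₁⟩
  -- `A n` increases to the density for `Ω × ℝ₊`, since the integrals converge by `IsDoleans`.
  · refine tendsto_of_integral_tendsto_of_monotone (fun n => hAi n) hGi ?_ ?_
      (ae_all_iff.2 fun n => hAG n)
    · have h₁ := hx.tendsto_Iic (univ : Set Ω)
      rw [← hG univ MeasurableSet.univ] at h₁
      simpa only [← hA _ univ MeasurableSet.univ, setIntegral_univ] using h₁
    · have := ae_all_iff.2 fun n : ℕ => hmono n ((n + 1 : ℕ) : ℝ≥0) (by simp)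
      filter_upwards [this] with ω hω
      exact monotone_nat_of_le_succ hω
  · have hint : ∀ n, Integrable
        ((H.F n).indicator fun ω => A (H.u n) ω - A (H.s n) ω) P := fun n =>
      ((hAi _).sub (hAi _)).indicator (H.F_mem n)
    rw [H.apply_carrier h0, NNReal.coe_sum]
    simp only [RectUnion.integral]
    rw [integral_finsetSum _ fun n _ => hint n]
    refine Finset.sum_congr rfl fun n _ => ?_
    rw [integral_indicator (H.F_mem n), integral_sub (hAi _).integrableOn (hAi _).integrableOn,
      hA _ _ (H.F_mem n), hA _ _ (H.F_mem n), prod_Iic_split _ (H.s_le_u n), NNReal.coe_add,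
      add_sub_cancel_left]

/-- An integrable function is determined by its integrals over the sets of an algebra generating
the `σ`-algebra. -/
theorem ae_eq_of_setIntegral_eq_of_isSetAlgebra {Ω : Type*} {mΩ : MeasurableSpace Ω}
    {𝒜 : Set (Set Ω)} (h𝒜 : IsSetAlgebra 𝒜) (hgen : mΩ = MeasurableSpace.generateFrom 𝒜)
    {P : Measure Ω} {f g : Ω → ℝ} (hf : Integrable f P) (hg : Integrable g P)
    (h : ∀ F ∈ 𝒜, ∫ ω in F, f ω ∂P = ∫ ω in F, g ω ∂P) : f =ᵐ[P] g := by
  refine Integrable.ae_eq_of_forall_setIntegral_eq f g hf hg fun F hF hlt => ?_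
  clear hlt
  induction F, hF using MeasurableSpace.induction_on_inter hgen
    h𝒜.isSetRing.isSetSemiring.isPiSystem with
  | empty => simp
  | basic F hF => exact h F hF
  | compl F hF ih =>
    have := h univ h𝒜.univ_mem
    rw [setIntegral_univ, setIntegral_univ] at this
    rw [← integral_add_compl hF hf, ← integral_add_compl hF hg, ih] at this
    exact add_left_cancel this
  | iUnion F hd hF ih =>
    rw [integral_iUnion hF hd hf.integrableOn, integral_iUnion hF hd hg.integrableOn]
    exact tsum_congr ih

end Processes

end FinAdd

/-! ### The equivalences and the properties of `I_x̄` -/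

theorem mainTheorem5 {Ω : Type*} [Nonempty Ω] [mΩ : MeasurableSpace Ω]
    (𝒜 : Set (Set Ω)) (h𝒜 : IsSetAlgebra 𝒜) (hgen : mΩ = MeasurableSpace.generateFrom 𝒜)
    (x : FinAdd.PosBa (Ω × ℝ≥0)) (hx : FinAdd.IsDoleans x) :
    List.TFAE [
      -- (i)
      ∃ P : Measure Ω, IsProbabilityMeasure P ∧
        ∃ A : ℝ≥0 → Ω → ℝ, FinAdd.IsIncreasing P A ∧
          FinAdd.Represents {F : Set Ω | MeasurableSet F} x P A ∧
          ∀ B : ℝ≥0 → Ω → ℝ, FinAdd.IsIncreasing P B → FinAdd.Represents 𝒜 x P B →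
            ∀ t, B t =ᵐ[P] A t,
      -- (ii)
      FinAdd.CountablyAdditiveOn x (FinAdd.fBar Ω) ∧ x (Set.univ ×ˢ {0}) = 0,
      -- (iii)
      ∃ P : Measure Ω, IsProbabilityMeasure P ∧
        ∃ I : (Ω × ℝ≥0 → ℝ) → Lp ℝ 1 P, FinAdd.IsIntegralOperator x P I] ∧
    -- properties of the operator
    ∀ (P : Measure Ω) [IsProbabilityMeasure P] (I : (Ω × ℝ≥0 → ℝ) → Lp ℝ 1 P),
      FinAdd.IsIntegralOperator x P I →
      -- positive
      (∀ h, FinAdd.MemL1 x h → (∀ z, 0 ≤ h z) → 0 ≤ I h) ∧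
      -- linear
      (∀ h g, FinAdd.MemL1 x h → FinAdd.MemL1 x g → I (h + g) = I h + I g) ∧
      (∀ (a : ℝ) (h), FinAdd.MemL1 x h → I (a • h) = a • I h) ∧
      -- continuous on `L¹(x̄)`: `‖I h‖ ≤ x̄(|h|)`, with equality for `h ≥ 0`
      (∀ h, FinAdd.MemL1 x h → ∃ c, FinAdd.HasIntegral x (fun z => |h z|) c ∧
        ‖I h‖ ≤ c ∧ ((∀ z, 0 ≤ h z) → ‖I h‖ = c)) ∧
      -- the norm of `I` over the unit ball of the bounded functions is `‖x̄‖`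
      IsLUB {r : ℝ | ∃ h, FinAdd.MemL1 x h ∧ (∀ z, |h z| ≤ 1) ∧ r = ‖I h‖} (FinAdd.mass x) ∧
      -- dominated convergence
      (∀ h : ℕ → Ω × ℝ≥0 → ℝ, (∀ n, FinAdd.MemL1 x (h n)) →
        (∀ z, BddAbove (Set.range fun n => |h n z|)) →
        FinAdd.MemL1 x (fun z => ⨆ n, |h n z|) →
        (∀ η : ℝ, 0 < η →
          Tendsto (fun n => P {ω | ∃ t, η < |h n (ω, t)|}) atTop (𝓝 0)) →
        Tendsto (fun n => I (h n)) atTop (𝓝 0)) := by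
  refine ⟨?_, ?_⟩
  · tfae_have 1 → 2 := by
      rintro ⟨P, hP, A, hA, hR, -⟩
      exact ⟨hR.countablyAdditiveOn hx hA, hR.apply_zero_section MeasurableSet.univ⟩
    tfae_have 2 → 1 := by
      rintro ⟨hca, h0⟩
      obtain ⟨P, hP, hac⟩ := hca.exists_probability
      obtain ⟨A, hA, hR⟩ := hca.exists_isIncreasing hx hac h0
      refine ⟨P, hP, A, hA, hR, fun B hB hRB t => ?_⟩
      refine FinAdd.ae_eq_of_setIntegral_eq_of_isSetAlgebra h𝒜 hgen (hB.integrable t)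
        (hA.integrable t) fun F hF => ?_
      have hFm : MeasurableSet F := by
        rw [hgen]
        exact MeasurableSpace.measurableSet_generateFrom hF
      rw [← hRB.apply_Ioc hB h𝒜.empty_mem hF hFm t,
        ← hR.apply_Ioc hA MeasurableSet.empty hFm hFm t]
    tfae_have 2 → 3 := by
      rintro ⟨hca, h0⟩
      obtain ⟨P, hP, hac⟩ := hca.exists_probability
      exact ⟨P, hP, hca.exists_isIntegralOperator hac h0⟩
    tfae_have 3 → 2 := by
      rintro ⟨P, hP, I, hI⟩
      exact ⟨hI.countablyAdditiveOn, hI.apply_zero_section⟩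
    tfae_finish
  · intro P hP I hI
    refine ⟨fun h hh h0 => (hI.solves h hh).nonneg h0, fun h g hh hg => ?_, fun a h hh => ?_,
      fun h hh => ?_, hI.isLUB_norm, fun h hh hbdd hs hlim => ?_⟩
    -- linearity: by uniqueness, as the right-hand sides solve the equations for `h + g`, `a • h`
    · have hmem : FinAdd.MemL1 x (h + g) := ⟨_, hh.choose_spec.add hg.choose_spec⟩
      exact (hI.unique _ hmem _ ((hI.solves h hh).add (hI.solves g hg))).symm
    · have hmem : FinAdd.MemL1 x (a • h) := ⟨_, hh.choose_spec.smul a⟩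
      exact (hI.unique _ hmem _ ((hI.solves h hh).smul a)).symm
    · obtain ⟨c, hc, -⟩ := hh.choose_spec.abs
      refine ⟨c, hc, (hI.solves h hh).norm_le hc, fun h0 => ?_⟩
      simp only [abs_of_nonneg (h0 _)] at hc
      exact (hI.solves h hh).norm_eq h0 hc
    · exact hI.dominated_convergence hh hs (fun n z => le_ciSup (hbdd z) n) hlim
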